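/- Let $\Gamma=(V,E)$ be a finite, connected, simple, $d$-valent graph with oriented edge set $E$; for $e\in E$ let $i(e)$, $t(e)$ be its initial and terminal vertex, $\bar e$ the reversed edge, and let $E^p$ be the set of oriented edges with initial vertex $p$. A *connection* $\theta$ is a family of bijections $\theta_e\colon E^{i(e)}\to E^{t(e)}$ with $\theta_e(e)=\bar e$ and $\theta_{\bar e}=\theta_e^{-1}$. A *compatibility system* $\lambda$ is a family of functions $\lambda_e\colon E^{i(e)}\to\mathbb{R}_{>0}$ with $\lambda_{\bar e}(\theta_e(e'))=1/\lambda_e(e')$. A *generalized 1-skeleton* $(\Gamma,\alpha,\theta,\lambda)$ in $\mathbb{R}^n$ is such data together with a map $\alpha\colon E\to\mathbb{R}^n$ such that for each $e\in E$ there is $m_e>0$ with $\alpha(e)=-m_e\alpha(\bar e)$, and $\alpha(e')-\lambda_e(e')\,\alpha(\theta_e(e'))\in\mathbb{R}\,\alpha(e)$ for all $e'\in E^{i(e)}\setminus\{e\}$. It is a *1-skeleton* if for each vertex $p$ the vectors $\alpha(e)$, $e\in E^p$, are pairwise linearly independent, and *effective* if for each $p$ they span $\mathbb{R}^n$. A $k$-valent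 *subskeleton* is a connected $k$-valent subgraph $\Gamma_0=(V_0,E_0)$ with $\theta_e(E_0^{i(e)})\subseteq E_0^{t(e)}$ for all $e\in E_0$, with the restricted data; edges with initial vertex in $V_0$ that are not in $E_0$ are *normal* to it. For a path $\gamma\colon p_0\to p_1\to\dots\to p_j$ put $K_\gamma=\theta_{p_{j-1}p_j}\circ\dots\circ\theta_{p_0p_1}$ and, for $e\in E^{p_0}$, let $|K_\gamma(e)|=\prod_{i=1}^{j}\lambda_{p_{i-1}p_i}\big(\theta_{p_{i-2}p_{i-1}}\circ\dots\circ\theta_{p_0p_1}(e)\big)$. The subskeleton has *trivial normal holonomy* if $K_\gamma(e)=e$ for every loop $\gamma$ in $\Gamma_0$ and every edge $e$ normal to $\Gamma_0$ at the base point of $\gamma$; it is *level* if $|K_\gamma(e)|=1$ for all such $\gamma$ and $e$ with $K_\gamma(e)=e$. A covector $\xi\in(\mathbb{R}^n)^*$ is *generic* if $\langle\xi,\alpha(e)\rangle\neq0$ for all edges $e$, and *polarizing* if moreover there is no oriented loop all of whose edges $e$ satisfy $\langle\xi,\alpha(e)\rangle>0$. A *$k$-face* is a $k$-valent subskeleton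 $\Gamma_0$ with $b_0=1$, i.e. such that for any covector $\xi$ generic for $\Gamma_0$ exactly one vertex $p$ of $\Gamma_0$ satisfies $\langle\xi,\alpha(e)\rangle>0$ for all $e\in E_0^p$ (for a 1-skeleton the number of such vertices does not depend on the generic $\xi$). A 1-skeleton is *reducible* if it admits a polarizing covector and any two distinct edges at any vertex lie in a unique $2$-face. A generalized 1-skeleton $(\Gamma,\alpha,\theta,\lambda)$ in $\mathbb{R}^n$ has a *total lift* if there are an effective (hence $d$-independent) generalized 1-skeleton $(\Gamma,A,\theta,\lambda)$ in $\mathbb{R}^d$, with the same $\Gamma,\theta,\lambda$, and a surjective linear map $\pi\colon\mathbb{R}^d\to\mathbb{R}^n$ with $\alpha=\pi\circ A$. **Theorem 1.** Let $(\Gamma,\alpha,\theta,\lambda)$ be an effective $d$-valent reducible 1-skeleton in $\mathbb{R}^n$. Then $(\Gamma,\alpha,\theta,\lambda)$ has a total lift if and only if $(\dagger)$ every $2$-face of $(\Gamma,\alpha,\theta,\lambda)$ is level and has trivial normal holonomy. -/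

import Mathlib

namespace OneSkel

/-- The set `E^p` of oriented edges (darts) of `G` with initial vertex `p`. -/
abbrev EdgesAt {V : Type*} (G : SimpleGraph V) (p : V) : Type _ :=
  {e : G.Dart // e.fst = p}

/-- A connection on `G`: for each oriented edge `e` a bijection `θ_e : E^{i(e)} → E^{t(e)}` with
`θ_e(e) = ē`, and such that `θ_e` and `θ_ē` are mutually inverse. -/
structure Connection {V : Type*} (G : SimpleGraph V) where
  /-- the bijections `θ_e` -/
  map : ∀ e : G.Dart, EdgesAt G e.fst ≃ EdgesAt G e.snd
  map_self : ∀ e : G.Dart, (map e ⟨e, rfl⟩ : G.Dart) = e.symm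
  map_symm : ∀ (e : G.Dart) (e' : EdgesAt G e.fst), map e.symm (map e e') = e'

/-- A pre 1-skeleton `(Γ, θ, λ)`: a connection together with a compatibility system, i.e. positive
functions `λ_e` on `E^{i(e)}` with `λ_ē ∘ θ_e = 1 / λ_e`. -/
structure PreSkeleton {V : Type*} (G : SimpleGraph V) extends Connection G where
  /-- the compatibility system `λ` -/
  lam : ∀ e : G.Dart, EdgesAt G e.fst → ℝ
  lam_pos : ∀ (e : G.Dart) (e' : EdgesAt G e.fst), 0 < lam e e'
  lam_symm : ∀ (e : G.Dart) (e' : EdgesAt G e.fst), lam e.symm (map e e') = 1 / lam e e'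

/-- `α` is a generalized axial function for the pre 1-skeleton `P`. -/
structure PreSkeleton.IsAxial {V : Type*} {G : SimpleGraph V} (P : PreSkeleton G) {n : ℕ}
    (α : G.Dart → (Fin n → ℝ)) : Prop where
  symm : ∀ e : G.Dart, ∃ m : ℝ, 0 < m ∧ α e = -(m • α e.symm)
  compat : ∀ (e : G.Dart) (e' : EdgesAt G e.fst), e'.1 ≠ e →
    ∃ c : ℝ, α e'.1 - P.lam e e' • α (P.map e e').1 = c • α e

/-- A generalized 1-skeleton `(Γ, α, θ, λ)` in `ℝ^n` with underlying graph `G`. -/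
structure GenSkeleton {V : Type*} (G : SimpleGraph V) (n : ℕ) extends PreSkeleton G where
  /-- the generalized axial function `α` -/
  axial : G.Dart → (Fin n → ℝ)
  isAxial : toPreSkeleton.IsAxial axial

namespace PreSkeleton

variable {V : Type*} {G : SimpleGraph V} (P : PreSkeleton G)

/-- The path-connection map `K_γ : E^p → E^q` of a path `γ` from `p` to `q`. -/
def transport : {p q : V} → G.Walk p q → EdgesAt G p → EdgesAt G q
  | _, _, .nil, e => e
  | _, _, .cons h w, e => transport w (P.map ⟨(_, _), h⟩ e)

/-- The local path-connection number `|K_γ(e)|`. -/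
def transportNumber : {p q : V} → G.Walk p q → EdgesAt G p → ℝ
  | _, _, .nil, _ => 1
  | _, _, .cons h w, e => P.lam ⟨(_, _), h⟩ e * transportNumber w (P.map ⟨(_, _), h⟩ e)

/-- The oriented edges of the subgraph `H` are preserved by the connection. -/
def TotallyGeodesic (H : G.Subgraph) : Prop :=
  ∀ (e : G.Dart) (e' : EdgesAt G e.fst), H.Adj e.fst e.snd → H.Adj e'.1.fst e'.1.snd →
    H.Adj (P.map e e').1.fst (P.map e e').1.snd

/-- The subgraph `H` is (the graph of) a `k`-valent subskeleton: a connected `k`-regular totally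
geodesic subgraph, which carries the restrictions of `α`, `θ`, `λ`. -/
structure IsSubskeleton (k : ℕ) (H : G.Subgraph) : Prop where
  connected : H.Connected
  valency : ∀ p ∈ H.verts, (H.neighborSet p).ncard = k
  geodesic : P.TotallyGeodesic H

/-- All edges of the path `w` of `G` belong to the subgraph `H`. -/
def WalkIn (H : G.Subgraph) {p q : V} (w : G.Walk p q) : Prop :=
  ∀ e ∈ w.darts, H.Adj e.fst e.snd

/-- Along every loop in `H`, the holonomy map fixes every edge normal to `H` at the base point. -/
def TrivialNormalHolonomy (H : G.Subgraph) : Prop :=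
  ∀ p ∈ H.verts, ∀ γ : G.Walk p p, WalkIn H γ →
    ∀ e : EdgesAt G p, ¬ H.Adj e.1.fst e.1.snd → P.transport γ e = e

/-- `H` is level: `|K_γ(e)| = 1` for every loop `γ` in `H` and every edge `e` normal to `H` at the
base point with `K_γ(e) = e`. -/
def Level (H : G.Subgraph) : Prop :=
  ∀ p ∈ H.verts, ∀ γ : G.Walk p p, WalkIn H γ →
    ∀ e : EdgesAt G p, ¬ H.Adj e.1.fst e.1.snd → P.transport γ e = e →
      P.transportNumber γ e = 1

end PreSkeleton

namespace GenSkeleton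

variable {V : Type*} {G : SimpleGraph V} {n : ℕ} (S : GenSkeleton G n)

/-- `α` is `k`-independent: any `k` distinct edges at a vertex have linearly independent
directions. -/
def Independent (k : ℕ) : Prop :=
  ∀ (p : V) (s : Finset (EdgesAt G p)), s.card = k →
    LinearIndependent ℝ (fun e : s => S.axial e.1.1)

/-- A 1-skeleton is a generalized 1-skeleton with `2`-independent axial function. -/
def IsOneSkeleton : Prop := S.Independent 2

/-- `α` is effective: at each vertex the directions of the edges span `ℝ^n`. -/
def Effective : Prop :=
  ∀ p : V, Submodule.span ℝ (Set.range fun e : EdgesAt G p => S.axial e.1) = ⊤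

/-- `ξ` is generic for the restriction of `α` to the subgraph `H`. -/
def GenericOn (ξ : Module.Dual ℝ (Fin n → ℝ)) (H : G.Subgraph) : Prop :=
  ∀ e : G.Dart, H.Adj e.fst e.snd → ξ (S.axial e) ≠ 0

/-- `ξ` is generic, and the orientation of `G` that it induces is acyclic (there is no oriented
loop). -/
def Polarizing (ξ : Module.Dual ℝ (Fin n → ℝ)) : Prop :=
  (∀ e : G.Dart, ξ (S.axial e) ≠ 0) ∧
    ∀ (p : V) (γ : G.Walk p p), (∀ e ∈ γ.darts, 0 < ξ (S.axial e)) → γ.length = 0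

/-- The index of `p` in the subgraph `H` with respect to `ξ`. -/
noncomputable def index (ξ : Module.Dual ℝ (Fin n → ℝ)) (H : G.Subgraph) (p : V) : ℕ :=
  {e : EdgesAt G p | H.Adj e.1.fst e.1.snd ∧ ξ (S.axial e.1) < 0}.ncard

/-- The `i`-th combinatorial Betti number of the subgraph `H`, computed with `ξ`. -/
noncomputable def betti (ξ : Module.Dual ℝ (Fin n → ℝ)) (H : G.Subgraph) (i : ℕ) : ℕ :=
  {p : V | p ∈ H.verts ∧ S.index ξ H p = i}.ncard

/-- `b_0(H) = 1`. For 2-independent axial functions the Betti numbers are the same for all generic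
covectors, of which there is at least one as soon as the edge directions are non-zero. -/
def Pointed (H : G.Subgraph) : Prop :=
  (∃ ξ, S.GenericOn ξ H) ∧ ∀ ξ, S.GenericOn ξ H → S.betti ξ H 0 = 1

/-- A `k`-face: a `k`-valent subskeleton with `b_0 = 1`. -/
def IsFace (k : ℕ) (H : G.Subgraph) : Prop :=
  S.IsSubskeleton k H ∧ S.Pointed H

/-- Any `k` edges at a vertex lie in a unique `k`-face. -/
def EnoughFaces (k : ℕ) : Prop :=
  ∀ (p : V) (s : Finset (EdgesAt G p)), s.card = k →
    ∃! H : G.Subgraph, S.IsFace k H ∧ ∀ e ∈ s, H.Adj e.1.fst e.1.snd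

/-- `S` admits a polarization and has enough `2`-faces. -/
def Reducible : Prop :=
  (∃ ξ, S.Polarizing ξ) ∧ S.EnoughFaces 2

/-- `S` is the projection, under a surjective linear map `ℝ^d → ℝ^n`, of an effective generalized
1-skeleton in `ℝ^d` with the same graph, connection and compatibility system. -/
def HasTotalLift (d : ℕ) : Prop :=
  ∃ T : GenSkeleton G d, T.toPreSkeleton = S.toPreSkeleton ∧ T.Effective ∧
    ∃ π : (Fin d → ℝ) →ₗ[ℝ] (Fin n → ℝ), Function.Surjective π ∧
      ∀ e : G.Dart, S.axial e = π (T.axial e)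

end GenSkeleton

end OneSkel

/-! Fix coefficients `c` with α(e') - λ_e(e') α(θ_e(e')) = c_e(e') α(e), including the case e' = e.
A total lift amounts to a d-dimensional space of scalar functions f on darts solving the same linear
system, the coordinates of the lift being a basis. Solving for the values of f at t(e) in terms of
those at i(e) gives `stepMap`, a connection on the bundle of functions on E^p, which has rank d. A
full space of solutions exists exactly when this connection has trivial holonomy.

Functions vanishing on the edges of a totally geodesic subgraph H see no `c` term along H, so they
are transported by K_γ and 1/|K_γ| alone (`TotallyGeodesic.walkMap_of_vanishing`).

If a lift exists, covectors of ℝ^d realize every function on E^p as the restriction of a solution.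
Taking indicators of normal edges forces K_γ(e) = e and |K_γ(e)| = 1.

Conversely, the solutions ξ∘α already realize all values on the two face edges at a vertex of a
2-face, by 2-independence, and (†) settles the remaining functions, so holonomy around each 2-face
is trivial. A polarization makes descent terminate, and 2-faces serve as diamonds, as in Newman's
lemma. Holonomy is therefore trivial on all loops, and the solutions extending the standard basis at
one vertex assemble into the lift. -/

namespace OneSkel

/-! ### The linear system and its transport along walks -/

namespace PreSkeleton

variable {V : Type*} {G : SimpleGraph V} (P : PreSkeleton G)
  (c : ∀ e : G.Dart, EdgesAt G e.fst → ℝ)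

/-- The edge transport, from functions on `E^{i(e)}` to functions on `E^{t(e)}`, determined by the
linear system `f(e') - λ_e(e') f(θ_e(e')) = c_e(e') f(e)`. -/
noncomputable def stepMap (e : G.Dart) :
    (EdgesAt G e.fst → ℝ) →ₗ[ℝ] (EdgesAt G e.snd → ℝ) where
  toFun f x := (f ((P.map e).symm x) - c e ((P.map e).symm x) * f ⟨e, rfl⟩) /
    P.lam e ((P.map e).symm x)
  map_add' f g := by ext x; simp only [Pi.add_apply]; ring
  map_smul' r f := by ext x; simp only [Pi.smul_apply, smul_eq_mul, RingHom.id_apply]; ring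

/-- The composition of the edge transports along a walk. -/
noncomputable def walkMap : {p q : V} → G.Walk p q →
    ((EdgesAt G p → ℝ) →ₗ[ℝ] (EdgesAt G q → ℝ))
  | _, _, .nil => LinearMap.id
  | _, _, .cons h w => walkMap w ∘ₗ P.stepMap c ⟨(_, _), h⟩

/-- The scalar function `f` on darts solves the linear system with coefficients `c`. -/
def IsSolution (f : G.Dart → ℝ) : Prop :=
  ∀ (e : G.Dart) (e' : EdgesAt G e.fst), f e'.1 - P.lam e e' * f (P.map e e').1 = c e e' * f e

theorem stepMap_map (e : G.Dart) (f : EdgesAt G e.fst → ℝ) (e' : EdgesAt G e.fst) :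
    P.stepMap c e f (P.map e e') = (f e' - c e e' * f ⟨e, rfl⟩) / P.lam e e' := by
  simp [stepMap]

theorem walkMap_cons {p q r : V} (h : G.Adj p q) (w : G.Walk q r) (f : EdgesAt G p → ℝ) :
    P.walkMap c (.cons h w) f = P.walkMap c w (P.stepMap c ⟨(p, q), h⟩ f) := rfl

theorem walkMap_append {p q r : V} (w : G.Walk p q) (w' : G.Walk q r) (f : EdgesAt G p → ℝ) :
    P.walkMap c (w.append w') f = P.walkMap c w' (P.walkMap c w f) := by
  induction w with
  | nil => rfl
  | cons h w ih => exact ih w' _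

variable {P c}

theorem IsSolution.stepMap_eq {f : G.Dart → ℝ} (hf : P.IsSolution c f) (e : G.Dart) :
    P.stepMap c e (fun x => f x.1) = fun x => f x.1 := by
  funext x
  obtain ⟨e', rfl⟩ := (P.map e).surjective x
  rw [stepMap_map, div_eq_iff (P.lam_pos e e').ne']
  linarith [hf e e']

theorem IsSolution.walkMap_eq {f : G.Dart → ℝ} (hf : P.IsSolution c f) {p q : V}
    (w : G.Walk p q) : P.walkMap c w (fun x => f x.1) = fun x => f x.1 := by
  induction w with
  | nil => rfl
  | cons h w ih => rw [walkMap_cons, ← ih]; exact congrArg _ (hf.stepMap_eq ⟨(_, _), h⟩)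

theorem isSolution_of_stepMap_eq {f : G.Dart → ℝ}
    (hf : ∀ e, P.stepMap c e (fun x => f x.1) = fun x => f x.1) : P.IsSolution c f := by
  intro e e'
  have h := congrFun (hf e) (P.map e e')
  rw [stepMap_map, div_eq_iff (P.lam_pos e e').ne'] at h
  dsimp only at h
  linarith

/-- On a connected graph a solution is determined by its values at one vertex. -/
theorem IsSolution.eq_of_eq_at (hG : G.Connected) {f g : G.Dart → ℝ} (hf : P.IsSolution c f)
    (hg : P.IsSolution c g) (p : V) (h : ∀ x : EdgesAt G p, f x.1 = g x.1) : f = g := by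
  funext e
  obtain ⟨w⟩ := hG.preconnected p e.fst
  have h1 := hf.walkMap_eq w
  rw [show (fun x : EdgesAt G p => f x.1) = fun x => g x.1 from funext h, hg.walkMap_eq w] at h1
  exact (congrFun h1 ⟨e, rfl⟩).symm

variable (P) in
theorem transportNumber_pos {p q : V} (w : G.Walk p q) (x : EdgesAt G p) :
    0 < P.transportNumber w x := by
  induction w with
  | nil => exact one_pos
  | cons h w ih => exact mul_pos (P.lam_pos ⟨(_, _), h⟩ x) (ih _)

theorem TotallyGeodesic.adj_map_iff {H : G.Subgraph} (hH : P.TotallyGeodesic H) {e : G.Dart}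
    (he : H.Adj e.fst e.snd) (e' : EdgesAt G e.fst) :
    H.Adj (P.map e e').1.fst (P.map e e').1.snd ↔ H.Adj e'.1.fst e'.1.snd := by
  refine ⟨fun h => ?_, hH e e' he⟩
  have := hH e.symm (P.map e e') he.symm h
  rwa [P.map_symm] at this

theorem TotallyGeodesic.adj_transport_iff {H : G.Subgraph} (hH : P.TotallyGeodesic H) {p q : V}
    (w : G.Walk p q) (hw : WalkIn H w) (x : EdgesAt G p) :
    H.Adj (P.transport w x).1.fst (P.transport w x).1.snd ↔ H.Adj x.1.fst x.1.snd := by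
  induction w with
  | nil => rfl
  | cons h w ih =>
    simp only [WalkIn, SimpleGraph.Walk.darts_cons, List.mem_cons, forall_eq_or_imp] at hw
    exact (ih hw.2 _).trans (hH.adj_map_iff (e := ⟨(_, _), h⟩) hw.1 x)

/-- Along walks in a totally geodesic subgraph, a function that vanishes on the edges of the
subgraph is transported by the holonomy and its local numbers. -/
theorem TotallyGeodesic.walkMap_of_vanishing {H : G.Subgraph} (hH : P.TotallyGeodesic H) {p q : V}
    (w : G.Walk p q) (hw : WalkIn H w) (f : EdgesAt G p → ℝ)
    (hf : ∀ x : EdgesAt G p, H.Adj x.1.fst x.1.snd → f x = 0) :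
    (∀ x : EdgesAt G q, H.Adj x.1.fst x.1.snd → P.walkMap c w f x = 0) ∧
      ∀ x, f x = P.transportNumber w x * P.walkMap c w f (P.transport w x) := by
  induction w with
  | nil => exact ⟨hf, fun x => (one_mul _).symm⟩
  | @cons u v _ h w ih =>
    simp only [WalkIn, SimpleGraph.Walk.darts_cons, List.mem_cons, forall_eq_or_imp] at hw
    have key : ∀ x : EdgesAt G u, P.stepMap c ⟨(u, v), h⟩ f (P.map ⟨(u, v), h⟩ x) =
        f x / P.lam ⟨(u, v), h⟩ x := by
      intro x
      refine (P.stepMap_map c ⟨(u, v), h⟩ f x).trans ?_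
      rw [hf ⟨⟨(u, v), h⟩, rfl⟩ hw.1, mul_zero, sub_zero]
    obtain ⟨h1, h2⟩ := ih hw.2 (P.stepMap c ⟨(u, v), h⟩ f) fun x hx => by
      obtain ⟨y, rfl⟩ := (P.map ⟨(u, v), h⟩).surjective x
      rw [key, hf y ((hH.adj_map_iff (e := ⟨(u, v), h⟩) hw.1 y).1 hx), zero_div]
    refine ⟨h1, fun x => ?_⟩
    have h3 := h2 (P.map ⟨(u, v), h⟩ x)
    rw [key] at h3
    refine ((div_eq_iff (P.lam_pos ⟨(u, v), h⟩ x).ne').1 h3).trans ?_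
    change _ = P.lam ⟨(u, v), h⟩ x * P.transportNumber w (P.map ⟨(u, v), h⟩ x) *
      P.walkMap c w _ (P.transport w (P.map ⟨(u, v), h⟩ x))
    ring

theorem walkMap_reverse (hc : ∀ e f, P.stepMap c e.symm (P.stepMap c e f) = f) {p q : V}
    (w : G.Walk p q) (f : EdgesAt G p → ℝ) :
    P.walkMap c w.reverse (P.walkMap c w f) = f := by
  induction w with
  | nil => rfl
  | cons h w ih =>
    rw [SimpleGraph.Walk.reverse_cons, walkMap_append, walkMap_cons _ _ h, ih]
    exact hc ⟨(_, _), h⟩ f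

theorem WalkIn.append {H : G.Subgraph} {p q r : V} {w : G.Walk p q} {w' : G.Walk q r}
    (hw : WalkIn H w) (hw' : WalkIn H w') : WalkIn H (w.append w') := by
  intro e he
  rw [SimpleGraph.Walk.darts_append, List.mem_append] at he
  exact he.elim (hw e) (hw' e)

theorem WalkIn.reverse {H : G.Subgraph} {p q : V} {w : G.Walk p q} (hw : WalkIn H w) :
    WalkIn H w.reverse := by
  intro e he
  rw [SimpleGraph.Walk.darts_reverse, List.mem_reverse, List.mem_map] at he
  obtain ⟨a, ha, rfl⟩ := he
  exact (hw a ha).symm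

theorem WalkIn.cons {H : G.Subgraph} {p q r : V} {w : G.Walk q r} {h : G.Adj p q}
    (h' : H.Adj p q) (hw : WalkIn H w) : WalkIn H (.cons h w) := by
  intro e he
  rw [SimpleGraph.Walk.darts_cons, List.mem_cons] at he
  rcases he with rfl | he
  exacts [h', hw e he]

/-- If the transport is trivial along all loops in `H`, it depends only on the end points of walks
in `H`. -/
theorem walkMap_eq_of_loops (hc : ∀ e f, P.stepMap c e.symm (P.stepMap c e f) = f)
    {H : G.Subgraph} {p q : V} (hH : ∀ γ : G.Walk p p, WalkIn H γ → ∀ f, P.walkMap c γ f = f)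
    (w w' : G.Walk p q) (hw : WalkIn H w) (hw' : WalkIn H w') (f : EdgesAt G p → ℝ) :
    P.walkMap c w f = P.walkMap c w' f := by
  have h := hH (w.append w'.reverse) (hw.append hw'.reverse) f
  rw [walkMap_append] at h
  have h2 := walkMap_reverse hc w'.reverse (P.walkMap c w f)
  rw [h, SimpleGraph.Walk.reverse_reverse] at h2
  exact h2.symm

/-- The diagonal coefficient encodes α(e) = -m α(ē); the bound 1 < c_e(e) is the positivity of m,
needed again when a solution is turned back into an axial function. -/
theorem IsAxial.exists_coeff {n : ℕ} {α : G.Dart → (Fin n → ℝ)} (hα : P.IsAxial α) :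
    ∃ c : ∀ e : G.Dart, EdgesAt G e.fst → ℝ, (∀ e, 1 < c e ⟨e, rfl⟩) ∧
      ∀ (e : G.Dart) (e' : EdgesAt G e.fst),
        α e'.1 - P.lam e e' • α (P.map e e').1 = c e e' • α e := by
  have h : ∀ (e : G.Dart) (e' : EdgesAt G e.fst), ∃ r : ℝ, (e'.1 = e → 1 < r) ∧
      α e'.1 - P.lam e e' • α (P.map e e').1 = r • α e := by
    intro e e'
    by_cases he : e'.1 = e
    · obtain rfl : e' = ⟨e, rfl⟩ := Subtype.ext he
      obtain ⟨m, hm, h⟩ := hα.symm e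
      have hl := P.lam_pos e ⟨e, rfl⟩
      -- Since θ_e(e) = ē and α(ē) = -α(e)/m, the left side is (1 + λ_e(e)/m) α(e).
      refine ⟨1 + P.lam e ⟨e, rfl⟩ / m, fun _ => by linarith [div_pos hl hm], ?_⟩
      rw [P.map_self e, h]
      ext i
      simp only [Pi.sub_apply, Pi.smul_apply, Pi.neg_apply, smul_eq_mul]
      field_simp
      ring
    · obtain ⟨r, hr⟩ := hα.compat e e' he
      exact ⟨r, fun h => absurd h he, hr⟩
  choose c hc using h
  exact ⟨c, fun e => (hc e ⟨e, rfl⟩).1 rfl, fun e e' => (hc e e').2⟩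

theorem isSolution_dual {n : ℕ} {α : G.Dart → (Fin n → ℝ)}
    (h : ∀ (e : G.Dart) (e' : EdgesAt G e.fst),
      α e'.1 - P.lam e e' • α (P.map e e').1 = c e e' • α e)
    (l : Module.Dual ℝ (Fin n → ℝ)) : P.IsSolution c (fun e => l (α e)) := by
  intro e e'
  have := congrArg l (h e e')
  simpa using this

/-- Going along e and back changes g by g(e) times a function independent of g. A single solution
nonzero at e, such as a generic covector composed with α, is fixed and so forces that function to
vanish. -/
theorem stepMap_symm_stepMap {f₀ : G.Dart → ℝ} (h₀ : P.IsSolution c f₀) (hne : ∀ e, f₀ e ≠ 0)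
    (e : G.Dart) (f : EdgesAt G e.fst → ℝ) : P.stepMap c e.symm (P.stepMap c e f) = f := by
  have formula : ∀ (g : EdgesAt G e.fst → ℝ) (x : EdgesAt G e.fst),
      P.stepMap c e.symm (P.stepMap c e g) x = g x - g ⟨e, rfl⟩ * (c e x + P.lam e x *
        (c e.symm (P.map e x) * ((1 - c e ⟨e, rfl⟩) / P.lam e ⟨e, rfl⟩))) := by
    intro g x
    have h1 := P.stepMap_map c e.symm (P.stepMap c e g) (P.map e x)
    rw [P.map_symm, P.lam_symm] at h1
    have hs : (⟨e.symm, rfl⟩ : EdgesAt G e.symm.fst) = P.map e ⟨e, rfl⟩ :=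
      Subtype.ext (P.map_self e).symm
    rw [hs] at h1
    refine h1.trans ?_
    rw [stepMap_map, stepMap_map]
    have := P.lam_pos e x
    have := P.lam_pos e ⟨e, rfl⟩
    field_simp
    ring
  funext x
  have h1 := formula (fun x => f₀ x.1) x
  rw [h₀.stepMap_eq e] at h1
  have h2 := congrFun (h₀.stepMap_eq e.symm) x
  have h3 := h1.symm.trans h2
  have h4 := (mul_eq_zero.1 (sub_eq_self.1 h3)).resolve_left (hne e)
  exact (formula f x).trans (by rw [h4, mul_zero, sub_zero])

end PreSkeleton

open PreSkeleton

/-! ### Descending walks and confluence through 2-faces -/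

namespace GenSkeleton

variable {V : Type*} {G : SimpleGraph V} {n : ℕ} (S : GenSkeleton G n)

/-- All edges of the walk `w` are descending with respect to `ξ`. -/
def Descending (ξ : Module.Dual ℝ (Fin n → ℝ)) {p q : V} (w : G.Walk p q) : Prop :=
  ∀ e ∈ w.darts, ξ (S.axial e) < 0

/-- No edge at `p` is descending with respect to `ξ`. -/
def IsBottom (ξ : Module.Dual ℝ (Fin n → ℝ)) (p : V) : Prop :=
  ∀ e : EdgesAt G p, ¬ ξ (S.axial e.1) < 0

/-- The relation "there is a descending edge from `p` to `q`". -/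
def Below (ξ : Module.Dual ℝ (Fin n → ℝ)) (q p : V) : Prop :=
  ∃ h : G.Adj p q, ξ (S.axial ⟨(p, q), h⟩) < 0

variable {S} {ξ : Module.Dual ℝ (Fin n → ℝ)}

theorem pos_symm_of_neg {e : G.Dart} (h : ξ (S.axial e) < 0) : 0 < ξ (S.axial e.symm) := by
  obtain ⟨m, hm, h'⟩ := S.isAxial.symm e
  rw [h', map_neg, map_smul, smul_eq_mul] at h
  exact pos_of_mul_pos_right (by linarith) hm.le

theorem neg_symm_of_pos {e : G.Dart} (h : 0 < ξ (S.axial e)) : ξ (S.axial e.symm) < 0 := by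
  obtain ⟨m, hm, h'⟩ := S.isAxial.symm e
  rw [h', map_neg, map_smul, smul_eq_mul] at h
  by_contra hcon
  nlinarith [not_lt.1 hcon]

/-- A descending cycle reversed is an ascending loop, since ξ has opposite signs on e and ē; on a
finite vertex set acyclicity gives termination. -/
theorem wellFounded_below [Finite V] (hξ : S.Polarizing ξ) : WellFounded (S.Below ξ) := by
  have hwalk : ∀ q p, Relation.TransGen (S.Below ξ) q p →
      ∃ w : G.Walk q p, 0 < w.length ∧ ∀ e ∈ w.darts, 0 < ξ (S.axial e) := by
    intro q p h
    induction h with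
    | single h =>
      obtain ⟨h, hneg⟩ := h
      refine ⟨.cons h.symm .nil, by simp, ?_⟩
      simpa using pos_symm_of_neg hneg
    | tail _ h ih =>
      obtain ⟨h, hneg⟩ := h
      obtain ⟨w, _, hw⟩ := ih
      refine ⟨w.append (.cons h.symm .nil), by simp, ?_⟩
      intro e he
      simp only [SimpleGraph.Walk.darts_append, List.mem_append, SimpleGraph.Walk.darts_cons,
        SimpleGraph.Walk.darts_nil, List.mem_singleton] at he
      rcases he with he | rfl
      exacts [hw e he, pos_symm_of_neg hneg]
  have hirr : Std.Irrefl (Relation.TransGen (S.Below ξ)) := ⟨fun p h => by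
    obtain ⟨w, h1, h2⟩ := hwalk p p h
    exact h1.ne' (hξ.2 p w h2)⟩
  exact Subrelation.wf (fun h => Relation.TransGen.single h)
    (Finite.wellFounded_of_trans_of_irrefl (Relation.TransGen (S.Below ξ)))

theorem Descending.cons {p q r : V} {w : G.Walk q r} {h : G.Adj p q}
    (h' : ξ (S.axial ⟨(p, q), h⟩) < 0) (hw : S.Descending ξ w) :
    S.Descending ξ (.cons h w) := by
  intro e he
  rw [SimpleGraph.Walk.darts_cons, List.mem_cons] at he
  rcases he with rfl | he
  exacts [h', hw e he]

theorem Descending.append {p q r : V} {w : G.Walk p q} {w' : G.Walk q r}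
    (hw : S.Descending ξ w) (hw' : S.Descending ξ w') : S.Descending ξ (w.append w') := by
  intro e he
  rw [SimpleGraph.Walk.darts_append, List.mem_append] at he
  exact he.elim (hw e) (hw' e)

theorem exists_descending_in [Finite V] (hξ : S.Polarizing ξ) (H : G.Subgraph) (p : V)
    (hp : p ∈ H.verts) : ∃ r ∈ H.verts, (∀ e : EdgesAt G r, H.Adj e.1.fst e.1.snd →
      ¬ ξ (S.axial e.1) < 0) ∧ ∃ w : G.Walk p r, WalkIn H w ∧ S.Descending ξ w := by
  induction p using (wellFounded_below hξ).induction with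
  | _ p ih =>
  by_cases hb : ∀ e : EdgesAt G p, H.Adj e.1.fst e.1.snd → ¬ ξ (S.axial e.1) < 0
  · exact ⟨p, hp, hb, .nil, by simp [WalkIn], by simp [Descending]⟩
  · push Not at hb
    obtain ⟨⟨⟨⟨u, v⟩, huv⟩, rfl⟩, hH, hneg⟩ := hb
    obtain ⟨r, hr, hbr, w, hw, hd⟩ := ih v ⟨huv, hneg⟩ hH.snd_mem
    exact ⟨r, hr, hbr, .cons huv w, hw.cons hH, hd.cons hneg⟩

theorem exists_descending [Finite V] (hξ : S.Polarizing ξ) (p : V) :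
    ∃ (r : V) (w : G.Walk p r), S.IsBottom ξ r ∧ S.Descending ξ w := by
  obtain ⟨r, _, hr, w, _, hw⟩ := exists_descending_in hξ ⊤ p trivial
  exact ⟨r, w, fun e => hr e e.1.adj, hw⟩

theorem Pointed.bottom_unique [Finite V] {H : G.Subgraph} (hH : S.Pointed H)
    (hξ : ∀ e, ξ (S.axial e) ≠ 0) {r r' : V} (hr : r ∈ H.verts) (hr' : r' ∈ H.verts)
    (hb : ∀ e : EdgesAt G r, H.Adj e.1.fst e.1.snd → ¬ ξ (S.axial e.1) < 0)
    (hb' : ∀ e : EdgesAt G r', H.Adj e.1.fst e.1.snd → ¬ ξ (S.axial e.1) < 0) : r = r' := by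
  have h1 := hH.2 ξ fun e _ => hξ e
  rw [betti, Set.ncard_eq_one] at h1
  obtain ⟨a, ha⟩ := h1
  have key : ∀ q ∈ H.verts, (∀ e : EdgesAt G q, H.Adj e.1.fst e.1.snd →
      ¬ ξ (S.axial e.1) < 0) → q = a := by
    intro q hq hbq
    rw [← Set.mem_singleton_iff, ← ha]
    refine ⟨hq, ?_⟩
    rw [index, show {e : EdgesAt G q | H.Adj e.1.fst e.1.snd ∧ ξ (S.axial e.1) < 0} = ∅ from
      Set.eq_empty_of_forall_notMem fun e he => hbq e he.1 he.2, Set.ncard_empty]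
  rw [key r hr hb, key r' hr' hb']

variable {c : ∀ e : G.Dart, EdgesAt G e.fst → ℝ}

/-- Confluence of descending walks: if the transport is trivial along loops in `2`-faces, then the
transport along a maximal descending walk depends only on its initial vertex. -/
theorem walkMap_descending_unique [Finite V] (hξ : S.Polarizing ξ) (hfaces : S.EnoughFaces 2)
    (hc : ∀ e f, S.stepMap c e.symm (S.stepMap c e f) = f)
    (hQ : ∀ H : G.Subgraph, S.IsFace 2 H → ∀ (p : V) (γ : G.Walk p p), p ∈ H.verts →
      WalkIn H γ → ∀ f, S.walkMap c γ f = f)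
    (p : V) : ∀ (r r' : V) (w : G.Walk p r) (w' : G.Walk p r'), S.Descending ξ w →
      S.Descending ξ w' → S.IsBottom ξ r → S.IsBottom ξ r' → ∀ f,
      (⟨r, S.walkMap c w f⟩ : Σ q, EdgesAt G q → ℝ) = ⟨r', S.walkMap c w' f⟩ := by
  induction p using (wellFounded_below hξ).induction with
  | _ p ih =>
  intro r r' w w' hw hw' hr hr' f
  cases w with
  | nil =>
    cases w' with
    | nil => rfl
    | cons h' w' => exact absurd (hw' _ List.mem_cons_self) (hr ⟨_, rfl⟩)
  | @cons _ a _ ha w =>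
    cases w' with
    | nil => exact absurd (hw _ List.mem_cons_self) (hr' ⟨_, rfl⟩)
    | @cons _ b _ hb w' =>
      have ha' : ξ (S.axial ⟨(p, a), ha⟩) < 0 := hw _ List.mem_cons_self
      have hb' : ξ (S.axial ⟨(p, b), hb⟩) < 0 := hw' _ List.mem_cons_self
      have hwt : S.Descending ξ w := fun e he => hw e (List.mem_cons_of_mem _ he)
      have hwt' : S.Descending ξ w' := fun e he => hw' e (List.mem_cons_of_mem _ he)
      by_cases hab : a = b
      · subst hab
        exact ih a ⟨ha, ha'⟩ r r' w w' hwt hwt' hr hr' _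
      classical
      let x : EdgesAt G p := ⟨⟨(p, a), ha⟩, rfl⟩
      let y : EdgesAt G p := ⟨⟨(p, b), hb⟩, rfl⟩
      -- The 2-face through the two diverging edges closes the diamond: descents inside it from a
      -- and b meet at its unique bottom vertex.
      have hxy : x ≠ y := fun h => hab (congrArg (fun z : EdgesAt G p => z.1.snd) h)
      obtain ⟨H, ⟨hH, hHxy⟩, -⟩ := hfaces p {x, y} (Finset.card_pair hxy)
      have hxH : H.Adj p a := hHxy x (by simp)
      have hyH : H.Adj p b := hHxy y (by simp)
      obtain ⟨s, hs, hbs, u, hu, hud⟩ := exists_descending_in hξ H a hxH.snd_mem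
      obtain ⟨s', hs', hbs', u', hu', hud'⟩ := exists_descending_in hξ H b hyH.snd_mem
      obtain rfl := hH.2.bottom_unique hξ.1 hs hs' hbs hbs'
      have heq := walkMap_eq_of_loops hc (fun γ hγ => hQ H hH p γ hxH.fst_mem hγ)
        (.cons ha u) (.cons hb u') (hu.cons hxH) (hu'.cons hyH) f
      -- A common continuation to a global bottom lets the induction hypothesis at a and at b
      -- compare both given walks with it.
      obtain ⟨t, v, ht, hv⟩ := exists_descending hξ s
      have h1 := ih a ⟨ha, ha'⟩ r t w (u.append v) hwt (hud.append hv) hr ht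
        (S.stepMap c ⟨(p, a), ha⟩ f)
      have h2 := ih b ⟨hb, hb'⟩ r' t w' (u'.append v) hwt' (hud'.append hv) hr' ht
        (S.stepMap c ⟨(p, b), hb⟩ f)
      rw [walkMap_append] at h1 h2
      refine h1.trans (Eq.trans ?_ h2.symm)
      exact congrArg (fun g => (⟨t, S.walkMap c v g⟩ : Σ q, EdgesAt G q → ℝ)) heq

/-- If the transport is trivial along loops in `2`-faces, it is trivial along all loops. -/
theorem walkMap_loop_eq [Finite V] (hξ : S.Polarizing ξ) (hfaces : S.EnoughFaces 2)
    (hc : ∀ e f, S.stepMap c e.symm (S.stepMap c e f) = f)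
    (hQ : ∀ H : G.Subgraph, S.IsFace 2 H → ∀ (p : V) (γ : G.Walk p p), p ∈ H.verts →
      WalkIn H γ → ∀ f, S.walkMap c γ f = f)
    {p : V} (γ : G.Walk p p) (f : EdgesAt G p → ℝ) : S.walkMap c γ f = f := by
  choose r δ hr hδ using exists_descending hξ (S := S)
  -- The normal form of a local function: its transport to the bottom. It is invariant under every
  -- step, hence under walks, and the invertible descent can then be cancelled.
  let N : ∀ q, (EdgesAt G q → ℝ) → Σ q, EdgesAt G q → ℝ := fun q g =>
    ⟨r q, S.walkMap c (δ q) g⟩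
  have hdesc : ∀ (u v : V) (h : G.Adj u v), ξ (S.axial ⟨(u, v), h⟩) < 0 → ∀ g,
      N u g = N v (S.stepMap c ⟨(u, v), h⟩ g) := fun u v h hneg g =>
    walkMap_descending_unique hξ hfaces hc hQ u _ _ (δ u) (.cons h (δ v)) (hδ u)
      ((hδ v).cons hneg) (hr u) (hr v) g
  have hstep : ∀ (u v : V) (h : G.Adj u v) (g), N u g = N v (S.stepMap c ⟨(u, v), h⟩ g) := by
    intro u v h g
    rcases lt_or_gt_of_ne (hξ.1 ⟨(u, v), h⟩) with hneg | hpos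
    · exact hdesc u v h hneg g
    · refine Eq.symm ((hdesc v u h.symm (neg_symm_of_pos hpos) _).trans ?_)
      exact congrArg (N u) (hc ⟨(u, v), h⟩ g)
  have hwalk : ∀ {u v : V} (w : G.Walk u v) (g), N u g = N v (S.walkMap c w g) := by
    intro u v w
    induction w with
    | nil => exact fun g => rfl
    | cons h w ih => exact fun g => (hstep _ _ h g).trans (ih _)
  have h1 := eq_of_heq (Sigma.mk.inj (hwalk γ f)).2
  have h2 := congrArg (S.walkMap c (δ p).reverse) h1
  rw [walkMap_reverse hc, walkMap_reverse hc] at h2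
  exact h2.symm

end GenSkeleton

/-! ### Covectors with prescribed values, and counting edges -/

theorem exists_dual_eq_of_linearIndependent {K E ι : Type*} [Field K] [AddCommGroup E] [Module K E]
    {v : ι → E} (hv : LinearIndependent K v) (f : ι → K) :
    ∃ l : Module.Dual K E, ∀ i, l (v i) = f i := by
  obtain ⟨g, hg⟩ := (Finsupp.linearCombination K v).exists_leftInverse_of_injective
    (LinearMap.ker_eq_bot.2 hv)
  refine ⟨Finsupp.linearCombination K f ∘ₗ g, fun i => ?_⟩
  have := LinearMap.congr_fun hg (Finsupp.single i 1)
  simp only [LinearMap.comp_apply, Finsupp.linearCombination_single, one_smul,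
    LinearMap.id_apply] at this
  simp [this]

/-- Oriented edges at `p` correspond to neighbours of `p`. -/
def edgesAtEquiv {V : Type*} (G : SimpleGraph V) (p : V) : EdgesAt G p ≃ G.neighborSet p where
  toFun e := ⟨e.1.snd, by obtain ⟨⟨⟨u, v⟩, h⟩, rfl⟩ := e; exact h⟩
  invFun q := ⟨⟨(p, q.1), q.2⟩, rfl⟩
  left_inv e := by obtain ⟨⟨⟨u, v⟩, h⟩, rfl⟩ := e; rfl
  right_inv q := rfl

theorem ncard_edges_eq {V : Type*} {G : SimpleGraph V} (H : G.Subgraph) (p : V) :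
    {e : EdgesAt G p | H.Adj e.1.fst e.1.snd}.ncard = (H.neighborSet p).ncard := by
  refine Set.ncard_congr (fun e _ => e.1.snd) ?_ ?_ ?_
  · rintro ⟨⟨⟨u, v⟩, h⟩, rfl⟩ he
    exact he
  · intro e e' _ _ h
    exact (edgesAtEquiv G p).injective (Subtype.ext h)
  · intro q hq
    exact ⟨⟨⟨(p, q), hq.adj_sub⟩, rfl⟩, hq, rfl⟩

/-! ### Trivial transport, lifts and normal holonomy -/

namespace GenSkeleton

variable {V : Type*} {G : SimpleGraph V} {n : ℕ} {S : GenSkeleton G n}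
  {c : ∀ e : G.Dart, EdgesAt G e.fst → ℝ}

/-- The transport is trivial along loops in a level `k`-valent subskeleton with trivial normal
holonomy if the axial function is `k`-independent. -/
theorem walkMap_loop_eq_of_level {k : ℕ} (hS : S.Independent k) (hk : k ≠ 0)
    (hc : ∀ (e : G.Dart) (e' : EdgesAt G e.fst),
      S.axial e'.1 - S.lam e e' • S.axial (S.map e e').1 = c e e' • S.axial e)
    {H : G.Subgraph} (hH : S.IsSubskeleton k H) (hlev : S.Level H)
    (hhol : S.TrivialNormalHolonomy H) {p : V} (γ : G.Walk p p) (hp : p ∈ H.verts)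
    (hγ : WalkIn H γ) (f : EdgesAt G p → ℝ) : S.walkMap c γ f = f := by
  have hcard := (ncard_edges_eq H p).trans (hH.valency p hp)
  -- `ncard` is 0 on infinite sets, so nonzero valency yields finiteness.
  have hfin := Set.finite_of_ncard_ne_zero (hcard.trans_ne hk)
  rw [Set.ncard_eq_toFinset_card _ hfin] at hcard
  -- Subtracting the solution l∘α, itself invariant under transport, leaves a function vanishing on
  -- the edges of H.
  obtain ⟨l, hl⟩ := exists_dual_eq_of_linearIndependent (hS p _ hcard) fun x => f x.1
  have hsol := isSolution_dual hc l
  let g : EdgesAt G p → ℝ := fun x => l (S.axial x.1)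
  have hv : ∀ x : EdgesAt G p, H.Adj x.1.fst x.1.snd → (f - g) x = 0 := fun x hx => by
    have := hl ⟨x, hfin.mem_toFinset.2 hx⟩
    simp only [Pi.sub_apply, g]
    exact sub_eq_zero.2 this.symm
  obtain ⟨h1, h2⟩ := hH.geodesic.walkMap_of_vanishing (c := c) γ hγ (f - g) hv
  have hfg : S.walkMap c γ (f - g) = f - g := by
    funext x
    by_cases hx : H.Adj x.1.fst x.1.snd
    · rw [h1 x hx, hv x hx]
    · have ht := hhol p hp γ hγ x hx
      rw [h2 x, ht, hlev p hp γ hγ x hx ht, one_mul]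
  rw [map_sub, hsol.walkMap_eq γ] at hfg
  exact sub_left_injective hfg

/-- A skeleton whose transport is trivial along all loops has a total lift. -/
theorem hasTotalLift_of_walkMap_loop_eq {d : ℕ} (hG : G.Connected) (heff : S.Effective)
    (hd : ∀ p, Nonempty (EdgesAt G p ≃ Fin d))
    (hc : ∀ (e : G.Dart) (e' : EdgesAt G e.fst),
      S.axial e'.1 - S.lam e e' • S.axial (S.map e e').1 = c e e' • S.axial e)
    (hc1 : ∀ e, 1 < c e ⟨e, rfl⟩)
    (hinv : ∀ e f, S.stepMap c e.symm (S.stepMap c e f) = f)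
    (hloop : ∀ (p : V) (γ : G.Walk p p) (f), S.walkMap c γ f = f) : S.HasTotalLift d := by
  obtain ⟨p⟩ := hG.nonempty
  obtain ⟨ε⟩ := hd p
  have hext : ∀ g : EdgesAt G p → ℝ, ∃ f : G.Dart → ℝ, S.IsSolution c f ∧
      ∀ x : EdgesAt G p, f x.1 = g x := by
    intro g
    have hw : ∀ q, Nonempty (G.Walk p q) := fun q => hG.preconnected p q
    let w : ∀ q, G.Walk p q := fun q => (hw q).some
    let f : G.Dart → ℝ := fun e => S.walkMap c (w e.fst) g ⟨e, rfl⟩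
    have hf : ∀ q, (fun x : EdgesAt G q => f x.1) = S.walkMap c (w q) g := by
      intro q
      funext ⟨e, he⟩
      subst he
      rfl
    refine ⟨f, isSolution_of_stepMap_eq fun e => ?_, fun x => ?_⟩
    · rw [hf, hf]
      have hpath := walkMap_eq_of_loops hinv (H := ⊤) (fun γ _ => hloop p γ)
        ((w e.fst).append (.cons e.adj .nil)) (w e.snd) (fun e _ => e.adj) (fun e _ => e.adj) g
      rw [walkMap_append] at hpath
      exact hpath
    · rw [← hloop p (w p) g, ← hf p]
  choose f hf hfp using fun i => hext (fun x => (Pi.single i 1 : Fin d → ℝ) (ε x))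
  let A : G.Dart → (Fin d → ℝ) := fun e i => f i e
  have hA : ∀ (e : G.Dart) (e' : EdgesAt G e.fst),
      A e'.1 - S.lam e e' • A (S.map e e').1 = c e e' • A e := fun e e' =>
    funext fun i => hf i e e'
  have hAp : ∀ i, A (ε.symm i).1 = Pi.single i 1 := by
    intro i
    funext j
    change f j (ε.symm i).1 = _
    rw [hfp]
    simp [Pi.single_apply, eq_comm]
  have hsymm : ∀ e, ∃ m : ℝ, 0 < m ∧ A e = -(m • A e.symm) := by
    intro e
    have h := hA e ⟨e, rfl⟩
    rw [S.map_self] at h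
    have h1 := sub_pos.2 (hc1 e)
    -- Obtained by solving A(e) - λ_e(e) A(ē) = c_e(e) A(e) for A(e).
    refine ⟨S.lam e ⟨e, rfl⟩ / (c e ⟨e, rfl⟩ - 1), div_pos (S.lam_pos _ _) h1, ?_⟩
    funext i
    have h2 := congrFun h i
    simp only [Pi.sub_apply, Pi.smul_apply, smul_eq_mul] at h2
    simp only [Pi.neg_apply, Pi.smul_apply, smul_eq_mul]
    field_simp
    linarith
  let T : GenSkeleton G d := ⟨S.toPreSkeleton, A, hsymm, fun e e' _ => ⟨_, hA e e'⟩⟩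
  have hdual : ∀ (l : Module.Dual ℝ (Fin d → ℝ)) (y : Fin d → ℝ),
      l y = ∑ i, y i * l (Pi.single i 1) := fun l y => by
    conv_lhs => rw [← Finset.univ_sum_single y, map_sum]
    refine Finset.sum_congr rfl fun i _ => ?_
    rw [← smul_eq_mul, ← map_smul, ← Pi.single_smul, smul_eq_mul, mul_one]
  let π : (Fin d → ℝ) →ₗ[ℝ] (Fin n → ℝ) :=
    Fintype.linearCombination ℝ (fun i => S.axial (ε.symm i).1)
  have hπ : ∀ e, S.axial e = π (A e) := by
    intro e
    funext j
    have h1 := isSolution_dual hc (LinearMap.proj j)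
    have h2 := isSolution_dual hA (LinearMap.proj j ∘ₗ π)
    refine congrFun (h1.eq_of_eq_at hG h2 p fun x => ?_) e
    obtain ⟨i, rfl⟩ := ε.symm.surjective x
    simp [hAp, π, Fintype.linearCombination_apply_single]
  refine ⟨T, rfl, fun q => ?_, π, ?_, hπ⟩
  -- A nonzero covector killing A at q gives a solution that vanishes at q, hence everywhere, in
  -- particular on the standard basis found at p.
  · by_contra hspan
    obtain ⟨l, hl, hl'⟩ := Submodule.exists_dual_map_eq_bot_of_lt_top (lt_top_iff_ne_top.2 hspan)
      inferInstance
    have hzero := (isSolution_dual hA l).eq_of_eq_at hG (isSolution_dual hA 0) q fun x => by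
      have hx : l (A x.1) ∈ Submodule.map l (Submodule.span ℝ
          (Set.range fun e : EdgesAt G q => T.axial e.1)) :=
        Submodule.mem_map_of_mem (Submodule.subset_span ⟨x, rfl⟩)
      rw [hl'] at hx
      simpa using hx
    refine hl (LinearMap.ext fun y => ?_)
    rw [hdual]
    refine Finset.sum_eq_zero fun i _ => ?_
    have := congrFun hzero (ε.symm i).1
    simp only [hAp, LinearMap.zero_apply] at this
    rw [this, mul_zero]
  · rw [← LinearMap.range_eq_top, Fintype.range_linearCombination, ← heff p]
    congr 1
    exact (ε.symm.surjective.range_comp fun x : EdgesAt G p => S.axial x.1)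

/-- In an effective `d`-valent skeleton in `ℝ^d`, every totally geodesic subgraph is level and has
trivial normal holonomy. -/
theorem Effective.level_and_trivialNormalHolonomy {d : ℕ} {T : GenSkeleton G d}
    (hT : T.Effective) (hd : ∀ p, Nonempty (EdgesAt G p ≃ Fin d)) {H : G.Subgraph}
    (hH : T.TotallyGeodesic H) : T.Level H ∧ T.TrivialNormalHolonomy H := by
  obtain ⟨c, -, hc⟩ := T.isAxial.exists_coeff
  have key : ∀ (p : V) (γ : G.Walk p p), WalkIn H γ → ∀ x : EdgesAt G p,
      ¬ H.Adj x.1.fst x.1.snd → T.transport γ x = x ∧ T.transportNumber γ x = 1 := by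
    intro p γ hγ x hx
    classical
    obtain ⟨ε⟩ := hd p
    have := Fintype.ofEquiv _ ε.symm
    have hli : LinearIndependent ℝ (fun e : EdgesAt G p => T.axial e.1) :=
      linearIndependent_of_top_le_span_of_card_eq_finrank (hT p).ge
        (by rw [Module.finrank_fin_fun, Fintype.card_congr ε, Fintype.card_fin])
    -- With l∘A the indicator of K_γ(x), the vanishing formula reads l(A(x)) = |K_γ(x)|, which is
    -- nonzero; hence x = K_γ(x) and the number is 1.
    obtain ⟨l, hl⟩ := exists_dual_eq_of_linearIndependent hli (Pi.single (T.transport γ x) 1)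
    have hsol := isSolution_dual hc l
    have hx' := (hH.adj_transport_iff γ hγ x).not.2 hx
    have h := (hH.walkMap_of_vanishing (c := c) γ hγ (fun y => l (T.axial y.1)) fun y hy => by
      rw [hl, Pi.single_eq_of_ne]
      rintro rfl
      exact hx' hy).2 x
    rw [hsol.walkMap_eq γ] at h
    simp only [hl, Pi.single_eq_same, mul_one] at h
    have hpos : T.transportNumber γ x ≠ 0 := (T.transportNumber_pos γ x).ne'
    rw [← h] at hpos
    have heq : T.transport γ x = x := by
      by_contra hne
      exact hpos (Pi.single_eq_of_ne (Ne.symm hne) _)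
    refine ⟨heq, ?_⟩
    rw [← h, heq, Pi.single_eq_same]
  exact ⟨fun p _ γ hγ x hx _ => (key p γ hγ x hx).2, fun p _ γ hγ x hx => (key p γ hγ x hx).1⟩

end GenSkeleton
end OneSkel

theorem theorem1 {V : Type*} [Finite V] (G : SimpleGraph V) [G.LocallyFinite]
    (hG : G.Connected) (d n : ℕ) (hd : G.IsRegularOfDegree d)
    (S : OneSkel.GenSkeleton G n) (hS : S.IsOneSkeleton) (hred : S.Reducible)
    (heff : S.Effective) :
    S.HasTotalLift d ↔
      ∀ Q : G.Subgraph, S.IsFace 2 Q → S.Level Q ∧ S.TrivialNormalHolonomy Q := by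
  have hcard : ∀ p, Nonempty (OneSkel.EdgesAt G p ≃ Fin d) := fun p =>
    ⟨(OneSkel.edgesAtEquiv G p).trans (Fintype.equivFinOfCardEq
      ((G.card_neighborSet_eq_degree p).trans (hd p)))⟩
  constructor
  · rintro ⟨T, hT, hTeff, -⟩ Q hQ
    have hgeo : T.TotallyGeodesic Q := hT ▸ hQ.1.geodesic
    exact hT ▸ hTeff.level_and_trivialNormalHolonomy hcard hgeo
  · intro hdag
    obtain ⟨⟨ξ, hξ⟩, hfaces⟩ := hred
    obtain ⟨c, hc1, hc⟩ := S.isAxial.exists_coeff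
    have hinv := OneSkel.PreSkeleton.stepMap_symm_stepMap
      (OneSkel.PreSkeleton.isSolution_dual hc ξ) hξ.1
    refine OneSkel.GenSkeleton.hasTotalLift_of_walkMap_loop_eq hG heff hcard hc hc1 hinv ?_
    intro p γ f
    refine OneSkel.GenSkeleton.walkMap_loop_eq hξ hfaces hinv (fun H hH q δ hq hδ g => ?_) γ f
    exact OneSkel.GenSkeleton.walkMap_loop_eq_of_level hS two_ne_zero hc hH.1 (hdag H hH).1
      (hdag H hH).2 δ hq hδ g
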